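/- **Confidence Regions for Piecewise Continuous Functions.** *Setting.* Let $\mathcal S$ be a compact metric space and $\{V_i\}_{i\in\mathcal I}$ a countable, locally finite partition of $\mathcal S$ into non-empty sets. A function $f:\mathcal S\to\mathbb R$ belongs to $P(\{V_i\})$ (is piecewise continuous subordinate to $\{V_i\}$) if for each $i$ the restriction $f|_{V_i}$ extends to a continuous function $f^i$ on $\overline{V_i}$. Let $\ell^\infty(\mathcal S)$ be the bounded real functions on $\mathcal S$ with the supremum norm, and let $\ell^\infty_k(\mathcal S)$ be its $k$-fold product. All suprema are in the extended reals, with $\sup_\emptyset=-\infty$. For $f\in P(\{V_i\})$ and functions $f_n$ on $\mathcal S$, $f$ is an *upper restrained bound* for $\{f_n\}$ if for all $i$ and all $s\in\overline{V_i}$ $$\lim_{\delta\downarrow0}\limsup_{n\to\infty}\sup_{s'\in B_\delta(s)\cap V_i}f_n(s')\le\max\big(f^i(s),f(s)\big),$$ and a *lower restrained bound* if $-f$ is an upper restrained bound for $\{-f_n\}$. For $F,F_n\subseteq\ell^\infty_k(\mathcal S)$, a map $\tilde H:F\to P(\{V_i\})$ is *suprema (infima) preserving* for maps $\tilde H_n:F_n\to\ell^\infty(\mathcal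 S)$ if, whenever $f_n\in F_n$, $f\in F$ and $f_n\to f$ uniformly, $\tilde H(f)$ is an upper (lower) restrained bound for $\{\tilde H_n(f_n)\}$. Let $(\Omega,\mathcal F,\mathbb P)$ be a probability space, and let $\mathbb P^*[B]=\inf\{\mathbb P[A]:A\supseteq B,\ A\in\mathcal F\}$ and $\mathbb P_*[B]=1-\mathbb P^*[\Omega\setminus B]$ be outer and inner probability. For arbitrary maps $X_n$ on $\Omega$ into a metric space and a Borel measurable limit $X$ that almost surely takes values in a separable set, $X_n\xrightarrow{d}X$ means $\mathbb E^*\varphi(X_n)\to\mathbb E\varphi(X)$ for all bounded continuous real $\varphi$, where $\mathbb E^*$ is outer expectation. Processes $\hat H_n:\Omega\to\ell^\infty(\mathcal S)$ *converge with upper (lower) restraint* to $H:\Omega\to P(\{V_i\})$ if $\hat H_n(s)\xrightarrow{d}H(s)$ for every $s\in\mathcal S$ and, for some $k$ and some $F,F_n\subseteq\ell^\infty_k(\mathcal S)$, $\hat H_n=\tilde H_n\circ\hat G_n$ and $H=\tilde H\circ G$ with $\hat G_n:\Omega\to F_n$, $G:\Omega\to F$, $\hat G_n\xrightarrow{d}G$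 in $\ell^\infty_k(\mathcal S)$, and $\tilde H$ suprema (infima) preserving for $\tilde H_n$. A pair $(\hat L_n,\hat U_n)$ of sequences of processes $\Omega\to\ell^\infty(\mathcal S)$ is a *confinement* of $\hat H_n$ with limit $(L,U)$ if, for every $n$, almost surely $\hat L_n(s)\le\hat H_n(s)\le\hat U_n(s)$ for all $s\in\mathcal S$, $\hat L_n$ converges to $L$ with lower restraint, and $\hat U_n$ converges to $U$ with upper restraint, through building blocks $\hat G_n,G$ and $\hat G_n',G'$ that converge jointly, $(\hat G_n,\hat G_n')\xrightarrow{d}(G,G')$. *Theorem.* Let $\mu\in\ell^\infty(\mathcal S)$, $\hat\mu_n:\Omega\to\ell^\infty(\mathcal S)$, $\tau_n>0$ with $\tau_n\to0$, and put $\hat H_n=\tau_n^{-1}(\hat\mu_n-\mu)$. Suppose that $\hat H_n$ converges pointwise in distribution, jointly over finitely many points (that is, $(\hat H_n(s_1),\dots,\hat H_n(s_m))\xrightarrow{d}(H(s_1),\dots,H(s_m))$ for all $s_1,\dots,s_m\in\mathcal S$), to a process $H:\Omega\to P(\{V_i\})$, and that $\hat H_n$ has a confinement $(\hat L_n,\hat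 U_n)$ with limit $(L,U)$. For $q\in\mathbb R$ let $$\mathcal L=\{\mu<0\},\quad \mathcal U=\{\mu>0\},\quad \hat{\mathcal L}=\{\tau_n^{-1}\hat\mu_n<-q\},\quad \hat{\mathcal U}=\{\tau_n^{-1}\hat\mu_n>q\},$$ $$\mathfrak u_i^+(0)=\bigcap_{\eta>0}\overline{\overline{\mu^{-1}([0,\eta])}\cap V_i},\qquad \mathfrak u_i^-(0)=\bigcap_{\eta>0}\overline{\overline{\mu^{-1}([-\eta,0])}\cap V_i}.$$ Then $$\text{(i)}\quad \liminf_{n\to\infty}\mathbb P_*\big[\hat{\mathcal L}\subseteq\mathcal L\ \wedge\ \hat{\mathcal U}\subseteq\mathcal U\big]\ \ge\ \mathbb P\Big[\sup_{i\in\mathcal I}\max\Big(\sup_{s\in\mathfrak u_i^+(0)}-L^i(s),\ \sup_{s\in\mathfrak u_i^-(0)}U^i(s)\Big)<q\Big],$$ $$\text{(ii)}\quad \limsup_{n\to\infty}\mathbb P^*\big[\hat{\mathcal L}\subseteq\mathcal L\ \wedge\ \hat{\mathcal U}\subseteq\mathcal U\big]\ \le\ \mathbb P\Big[\sup_{s\in\mu^{-1}(0)}|H(s)|\le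 q\Big].$$ -/

import Mathlib

open Set Filter Topology MeasureTheory
open scoped ENNReal BoundedContinuousFunction

namespace ConfidenceRegions

noncomputable section

/-- The bounded real functions on `S`, with the supremum norm. -/
abbrev LInf (S : Type*) : Type _ := lp (fun _ : S => ℝ) ⊤

/-! ### Outer and inner probability, outer expectation, weak convergence of arbitrary maps -/

/-- Outer probability of an arbitrary set: infimum of `P A` over measurable `A ⊇ B`. -/
def outerProb {Ω : Type*} [MeasurableSpace Ω] (P : Measure Ω) (B : Set Ω) : ℝ≥0∞ :=
  ⨅ (A : Set Ω) (_ : B ⊆ A) (_ : MeasurableSet A), P A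

/-- Inner probability of an arbitrary set. -/
def innerProb {Ω : Type*} [MeasurableSpace Ω] (P : Measure Ω) (B : Set Ω) : ℝ≥0∞ :=
  1 - outerProb P Bᶜ

/-- Outer expectation of an arbitrary function (only used for bounded functions and
probability measures, where the set below is nonempty and bounded below). -/
def outerExp {Ω : Type*} [MeasurableSpace Ω] (P : Measure Ω) (T : Ω → ℝ) : ℝ :=
  sInf {r : ℝ | ∃ W : Ω → ℝ, Measurable W ∧ Integrable W P ∧ (∀ ω, T ω ≤ W ω) ∧
    r = ∫ ω, W ω ∂P}

/-- Weak convergence (in the sense of Hoffmann-Jørgensen, with outer expectations) of arbitrary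
maps `X n : Ω → E` to a Borel limit `X : Ω → E` in a metrizable space.  `AEStronglyMeasurable`
says that, up to a null set, the limit is Borel measurable with separable range; the maps `X n`
need not be measurable. -/
def WeakConv {Ω E : Type*} [MeasurableSpace Ω] [TopologicalSpace E] (P : Measure Ω)
    (X : ℕ → Ω → E) (X' : Ω → E) : Prop :=
  AEStronglyMeasurable X' P ∧
    ∀ φ : E →ᵇ ℝ, Tendsto (fun n => outerExp P (fun ω => φ (X n ω))) atTop
      (𝓝 (∫ ω, φ (X' ω) ∂P))

/-- Univariate convergence in distribution at every point. -/
def PointwiseWeakConv {Ω S : Type*} [MeasurableSpace Ω] (P : Measure Ω)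
    (X : ℕ → Ω → S → ℝ) (X' : Ω → S → ℝ) : Prop :=
  ∀ s : S, WeakConv P (fun n ω => X n ω s) (fun ω => X' ω s)

/-- Pointwise convergence in distribution of processes, jointly over finitely many points
(convergence of the finite-dimensional distributions). -/
def FiniteDimWeakConv {Ω S : Type*} [MeasurableSpace Ω] (P : Measure Ω)
    (X : ℕ → Ω → S → ℝ) (X' : Ω → S → ℝ) : Prop :=
  ∀ T : Finset S, WeakConv P (fun n ω => fun t : T => X n ω t) (fun ω => fun t : T => X' ω t)

/-! ### Partitions, piecewise continuous functions and restrained bounds -/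

/-- A locally finite partition of `S` into nonempty sets. -/
structure IsLocallyFinitePartition {S ι : Type*} [TopologicalSpace S] (V : ι → Set S) : Prop where
  nonempty : ∀ i, (V i).Nonempty
  disjoint : Pairwise fun i j => Disjoint (V i) (V j)
  cover : ⋃ i, V i = univ
  locallyFinite : LocallyFinite V

/-- `f` is piecewise continuous subordinate to `V`: each restriction `f|V i` extends to a
continuous function on the closure of `V i`. -/
def IsPiecewiseContinuous {S ι : Type*} [TopologicalSpace S] (V : ι → Set S) (f : S → ℝ) : Prop :=
  ∀ i, ∃ g : S → ℝ, ContinuousOn g (closure (V i)) ∧ EqOn g f (V i)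

/-- The continuous extension of `f|V i` to the closure of `V i`; its value at `s` is the limit of
`f` at `s` within `V i`.  It is only evaluated at points of `closure (V i)`. -/
def contExt {S ι : Type*} [TopologicalSpace S] (V : ι → Set S) (f : S → ℝ) (i : ι) : S → ℝ :=
  extendFrom (V i) f

/-- `f` is an upper restrained bound for the sequence `fn`.  The limsup is monotone in `δ`, so the
limit as `δ ↓ 0` is the infimum over `δ > 0`; suprema are taken in the extended reals, so that the
supremum over the empty set is `-∞`. -/
def IsUpperRestrainedBound {S ι : Type*} [MetricSpace S] (V : ι → Set S)
    (fn : ℕ → S → ℝ) (f : S → ℝ) : Prop :=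
  ∀ i, ∀ s ∈ closure (V i),
    (⨅ (δ : ℝ) (_ : 0 < δ),
      limsup (fun n => ⨆ s' ∈ Metric.ball s δ ∩ V i, ((fn n s' : ℝ) : EReal)) atTop) ≤
    ((max (contExt V f i s) (f s) : ℝ) : EReal)

/-- `f` is a lower restrained bound for `fn`. -/
def IsLowerRestrainedBound {S ι : Type*} [MetricSpace S] (V : ι → Set S)
    (fn : ℕ → S → ℝ) (f : S → ℝ) : Prop :=
  IsUpperRestrainedBound V (fun n s => - fn n s) (fun s => - f s)

/-! ### Suprema and infima preserving maps -/

/-- `Ht : F → P(V)` is suprema preserving for `Htn n : Fn n → ℓ^∞(S)`, where `F` and `Fn n` are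
subsets of the `k`-fold product of `ℓ^∞(S)` with the uniform norm.  (The values of `Ht`, `Htn n`
outside `F`, `Fn n` play no role.) -/
def SupremaPreserving {S ι : Type*} [MetricSpace S] {k : ℕ} (V : ι → Set S)
    (F : Set (Fin k → LInf S)) (Fn : ℕ → Set (Fin k → LInf S))
    (Ht : (Fin k → LInf S) → S → ℝ) (Htn : ℕ → (Fin k → LInf S) → LInf S) : Prop :=
  (∀ f ∈ F, IsPiecewiseContinuous V (Ht f)) ∧
    ∀ (fn : ℕ → Fin k → LInf S) (f : Fin k → LInf S), (∀ n, fn n ∈ Fn n) → f ∈ F →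
      Tendsto fn atTop (𝓝 f) →
      IsUpperRestrainedBound V (fun n s => (Htn n (fn n) : S → ℝ) s) (Ht f)

/-- `Ht : F → P(V)` is infima preserving for `Htn n : Fn n → ℓ^∞(S)`. -/
def InfimaPreserving {S ι : Type*} [MetricSpace S] {k : ℕ} (V : ι → Set S)
    (F : Set (Fin k → LInf S)) (Fn : ℕ → Set (Fin k → LInf S))
    (Ht : (Fin k → LInf S) → S → ℝ) (Htn : ℕ → (Fin k → LInf S) → LInf S) : Prop :=
  (∀ f ∈ F, IsPiecewiseContinuous V (Ht f)) ∧
    ∀ (fn : ℕ → Fin k → LInf S) (f : Fin k → LInf S), (∀ n, fn n ∈ Fn n) → f ∈ F →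
      Tendsto fn atTop (𝓝 f) →
      IsLowerRestrainedBound V (fun n s => (Htn n (fn n) : S → ℝ) s) (Ht f)

/-! ### Restrained convergence of processes and confinements -/

/-- `Hn` converges to `H` with upper restraint, the building blocks being `Gn` and `G`:
`Hn` converges to `H` in distribution at each point, `Hn = Htn ∘ Gn` and `H = Ht ∘ G` with `Ht`
suprema preserving for `Htn`.  The functional weak convergence of `Gn` to `G` is required
separately. -/
def UpperRestraintVia {Ω S ι : Type*} [MeasurableSpace Ω] [MetricSpace S] {k : ℕ}
    (P : Measure Ω) (V : ι → Set S) (Hn : ℕ → Ω → LInf S) (H : Ω → S → ℝ)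
    (Gn : ℕ → Ω → Fin k → LInf S) (G : Ω → Fin k → LInf S) : Prop :=
  PointwiseWeakConv P (fun n ω => (Hn n ω : S → ℝ)) H ∧
    ∃ (F : Set (Fin k → LInf S)) (Fn : ℕ → Set (Fin k → LInf S))
      (Ht : (Fin k → LInf S) → S → ℝ) (Htn : ℕ → (Fin k → LInf S) → LInf S),
      SupremaPreserving V F Fn Ht Htn ∧
      (∀ n ω, Gn n ω ∈ Fn n) ∧ (∀ ω, G ω ∈ F) ∧
      (∀ n ω, Hn n ω = Htn n (Gn n ω)) ∧ ∀ ω, H ω = Ht (G ω)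

/-- `Hn` converges to `H` with lower restraint, the building blocks being `Gn` and `G`. -/
def LowerRestraintVia {Ω S ι : Type*} [MeasurableSpace Ω] [MetricSpace S] {k : ℕ}
    (P : Measure Ω) (V : ι → Set S) (Hn : ℕ → Ω → LInf S) (H : Ω → S → ℝ)
    (Gn : ℕ → Ω → Fin k → LInf S) (G : Ω → Fin k → LInf S) : Prop :=
  PointwiseWeakConv P (fun n ω => (Hn n ω : S → ℝ)) H ∧
    ∃ (F : Set (Fin k → LInf S)) (Fn : ℕ → Set (Fin k → LInf S))
      (Ht : (Fin k → LInf S) → S → ℝ) (Htn : ℕ → (Fin k → LInf S) → LInf S),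
      InfimaPreserving V F Fn Ht Htn ∧
      (∀ n ω, Gn n ω ∈ Fn n) ∧ (∀ ω, G ω ∈ F) ∧
      (∀ n ω, Hn n ω = Htn n (Gn n ω)) ∧ ∀ ω, H ω = Ht (G ω)

/-- `(Ln, Un)` is a confinement of `Hn` with limit `(L, U)`: almost surely `Ln ≤ Hn ≤ Un` on `S`,
`Ln` converges to `L` with lower restraint and `Un` converges to `U` with upper restraint, the
building blocks of the two convergences converging weakly jointly. -/
def IsConfinement {Ω S ι : Type*} [MeasurableSpace Ω] [MetricSpace S]
    (P : Measure Ω) (V : ι → Set S) (Hn Ln Un : ℕ → Ω → LInf S) (L U : Ω → S → ℝ) : Prop :=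
  (∀ n, ∀ᵐ ω ∂P, ∀ s : S, Ln n ω s ≤ Hn n ω s ∧ Hn n ω s ≤ Un n ω s) ∧
    ∃ (k l : ℕ) (Gn : ℕ → Ω → Fin k → LInf S) (G : Ω → Fin k → LInf S)
      (Gn' : ℕ → Ω → Fin l → LInf S) (G' : Ω → Fin l → LInf S),
      LowerRestraintVia P V Ln L Gn G ∧ UpperRestraintVia P V Un U Gn' G' ∧
      WeakConv P (fun n ω => (Gn n ω, Gn' n ω)) (fun ω => (G ω, G' ω))

/-! ### Confidence regions -/

/-- The normalized error `τ_n⁻¹ (μ̂_n - μ)`. -/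
def normalizedError {Ω S : Type*} (τ : ℕ → ℝ) (μ : LInf S) (μhat : ℕ → Ω → LInf S)
    (n : ℕ) (ω : Ω) : LInf S :=
  (τ n)⁻¹ • (μhat n ω - μ)

/-- The event that `{τ_n⁻¹ μ̂_n < -q} ⊆ {μ < 0}` and `{τ_n⁻¹ μ̂_n > q} ⊆ {μ > 0}`. -/
def inclusionEvent {Ω S : Type*} (τ : ℕ → ℝ) (μ : LInf S) (μhat : ℕ → Ω → LInf S)
    (q : ℝ) (n : ℕ) : Set Ω :=
  {ω | {s : S | (τ n)⁻¹ * μhat n ω s < -q} ⊆ {s : S | μ s < 0} ∧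
    {s : S | q < (τ n)⁻¹ * μhat n ω s} ⊆ {s : S | 0 < μ s}}

/-- The set `𝔲_i^+(0)`. -/
def uPlus {S ι : Type*} [TopologicalSpace S] (V : ι → Set S) (μ : S → ℝ) (i : ι) : Set S :=
  ⋂ (η : ℝ) (_ : 0 < η), closure (closure (μ ⁻¹' Icc 0 η) ∩ V i)

/-- The set `𝔲_i^-(0)`. -/
def uMinus {S ι : Type*} [TopologicalSpace S] (V : ι → Set S) (μ : S → ℝ) (i : ι) : Set S :=
  ⋂ (η : ℝ) (_ : 0 < η), closure (closure (μ ⁻¹' Icc (-η) 0) ∩ V i)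

end

end ConfidenceRegions

open ConfidenceRegions

open ConfidenceRegions

namespace ConfidenceRegions

/-! ### Weak convergence of arbitrary maps -/

section WeakConvergence

variable {Ω : Type*} [MeasurableSpace Ω] {P : Measure Ω}

/-! Bound (i) is proved through its complement. If an inclusion fails at stage `n`, the confinement
almost surely gives a point with `0 ≤ μ s` at which `-Lhat` exceeds `q + (τ n)⁻¹ * μ s`, or the
mirror image with `Uhat` and `-μ`. Consider deterministic building blocks that converge and fail
infinitely often. By compactness the bad points cluster; since `(τ n)⁻¹` diverges while the
restrained bound is finite, `μ` tends to `0` along them, and the bound forces a value of at least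
`q` on `uPlus` or `uMinus` (`IsUpperRestrainedBound.exists_mem_uPlus`).
`WeakConv.limsup_measure_le_of_seq` turns this statement about sequences into one about
probabilities, using only the portmanteau inequality for closed sets.

Bound (ii) needs only finite-dimensional convergence: on the inclusion event the normalized error is
at most `q` in absolute value at every zero of `μ`. Portmanteau on finite sets of zeros, then
continuity of measure and of the paths on each cell, gives the full supremum. -/

lemma outerProb_eq (B : Set Ω) : outerProb P B = P B :=
  (measure_eq_iInf B).symm

/-- Markov's inequality for each measurable majorant `W`. The bound `b` only ensures that a majorant
exists, since `sInf ∅ = 0` would be useless. -/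
lemma measure_le_ofReal_outerExp [IsProbabilityMeasure P] {T : Ω → ℝ} {B : Set Ω} {b : ℝ}
    (h0 : ∀ ω, 0 ≤ T ω) (hb : ∀ ω, T ω ≤ b) (h1 : ∀ ω ∈ B, 1 ≤ T ω) :
    P B ≤ ENNReal.ofReal (outerExp P T) := by
  rw [← ofReal_measureReal (measure_ne_top P B)]
  refine ENNReal.ofReal_le_ofReal (le_csInf ?_ ?_)
  · exact ⟨_, fun _ => b, measurable_const, integrable_const b, hb, rfl⟩
  · rintro r ⟨W, -, hWi, hTW, rfl⟩
    have hW := mul_meas_ge_le_integral_of_nonneg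
      (ae_of_all P fun ω => (h0 ω).trans (hTW ω)) hWi 1
    rw [one_mul] at hW
    exact (measureReal_mono fun ω hω => (h1 ω hω).trans (hTW ω)).trans hW

lemma nullMeasurableSet_preimage_of_isClosed {E : Type*} [TopologicalSpace E]
    [TopologicalSpace.PseudoMetrizableSpace E] {X : Ω → E} (hX : AEStronglyMeasurable X P)
    {C : Set E} (hC : IsClosed C) : NullMeasurableSet (X ⁻¹' C) P := by
  borelize E
  exact hX.aemeasurable.nullMeasurable hC.measurableSet

/-- The portmanteau inequality for closed sets. -/
lemma WeakConv.limsup_measure_preimage_le [IsProbabilityMeasure P] {E : Type*}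
    [TopologicalSpace E] [TopologicalSpace.PseudoMetrizableSpace E] {X : ℕ → Ω → E} {X' : Ω → E}
    (h : WeakConv P X X') {C : Set E} (hC : IsClosed C) :
    limsup (fun n => P (X n ⁻¹' C)) atTop ≤ P (X' ⁻¹' C) := by
  borelize E
  have hX' : AEMeasurable X' P := h.1.aemeasurable
  have hlim := HasOuterApproxClosed.tendsto_lintegral_apprSeq hC (P.map X')
  rw [Measure.map_apply_of_aemeasurable hX' hC.measurableSet] at hlim
  refine ge_of_tendsto' hlim fun j => ?_
  let φ : E →ᵇ ℝ := BoundedContinuousFunction.mkOfBound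
    ⟨fun x => (hC.apprSeq j x : ℝ), by fun_prop⟩ 1 fun x y => by
      have h1 := HasOuterApproxClosed.apprSeq_apply_le_one hC j x
      have h2 := HasOuterApproxClosed.apprSeq_apply_le_one hC j y
      rw [Real.dist_eq, abs_le]
      have h1' : (hC.apprSeq j x : ℝ) ≤ 1 := by exact_mod_cast h1
      have h2' : (hC.apprSeq j y : ℝ) ≤ 1 := by exact_mod_cast h2
      have h3 := (hC.apprSeq j x).coe_nonneg
      have h4 := (hC.apprSeq j y).coe_nonneg
      constructor <;> simp only [ContinuousMap.coe_mk] <;> linarith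
  have hφ : ∀ x, φ x = (hC.apprSeq j x : ℝ) := fun x => rfl
  have hint : Integrable (fun ω => φ (X' ω)) P :=
    Integrable.of_bound (φ.continuous.comp_aestronglyMeasurable h.1) ‖φ‖
      (ae_of_all _ fun ω => φ.norm_coe_le_norm _)
  have hval : ∫⁻ x, hC.apprSeq j x ∂(P.map X') = ENNReal.ofReal (∫ ω, φ (X' ω) ∂P) := by
    rw [ofReal_integral_eq_lintegral_ofReal hint
      (ae_of_all _ fun ω => (hC.apprSeq j (X' ω)).coe_nonneg), lintegral_map' _ hX']
    · simp [hφ]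
    · exact (hC.apprSeq j).continuous.measurable.coe_nnreal_ennreal.aemeasurable
  rw [hval, ← ((ENNReal.continuous_ofReal.tendsto _).comp (h.2 φ)).limsup_eq]
  refine limsup_le_limsup (Eventually.of_forall fun n => ?_)
  refine measure_le_ofReal_outerExp (b := 1) (fun ω => (hC.apprSeq j (X n ω)).coe_nonneg)
    (fun ω => ?_) fun ω hω => ?_
  · rw [hφ]; exact_mod_cast HasOuterApproxClosed.apprSeq_apply_le_one hC j _
  · rw [hφ, HasOuterApproxClosed.apprSeq_apply_eq_one hC j hω]; simp

/-- Almost every value of the limit is approximated by the sets in which the sequence lives. -/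
lemma WeakConv.ae_tendsto_infDist [IsProbabilityMeasure P] {E : Type*} [PseudoMetricSpace E]
    {X : ℕ → Ω → E} {X' : Ω → E} (h : WeakConv P X X') {F : ℕ → Set E}
    (hF : ∀ n ω, X n ω ∈ F n) :
    ∀ᵐ ω ∂P, Tendsto (fun n => Metric.infDist (X' ω) (F n)) atTop (𝓝 0) := by
  obtain ⟨t, ⟨c, hc, htc⟩, ht⟩ := h.1.isSeparable_ae_range
  -- If infinitely many `F n` miss a ball, those `X n` lie in its closed complement surely, so by
  -- portmanteau the limit does almost surely. Separability reduces the claim to countably many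
  -- balls.
  have key : ∀ (x : E) (r : ℝ), ∀ᵐ ω ∂P, X' ω ∈ Metric.ball x r →
      ∀ᶠ n in atTop, (F n ∩ Metric.ball x r).Nonempty := by
    intro x r
    by_cases hev : ∀ᶠ n in atTop, (F n ∩ Metric.ball x r).Nonempty
    · exact ae_of_all _ fun _ _ => hev
    · have hcl : IsClosed (Metric.ball x r)ᶜ := Metric.isOpen_ball.isClosed_compl
      have h1 : 1 ≤ P (X' ⁻¹' (Metric.ball x r)ᶜ) := by
        refine le_trans (le_limsup_of_frequently_le' ?_) (h.limsup_measure_preimage_le hcl)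
        refine (not_eventually.1 hev).mono fun n hn => ?_
        have : X n ⁻¹' (Metric.ball x r)ᶜ = univ :=
          eq_univ_of_forall fun ω hω => hn ⟨X n ω, hF n ω, hω⟩
        rw [this, measure_univ]
      have hae : ∀ᵐ ω ∂P, X' ω ∈ (Metric.ball x r)ᶜ :=
        (mem_ae_iff_prob_eq_one₀ (nullMeasurableSet_preimage_of_isClosed h.1 hcl)).2
          (le_antisymm prob_le_one h1)
      exact hae.mono fun ω hω hω' => absurd hω' hω
  have key' : ∀ᵐ ω ∂P, ∀ x ∈ c, ∀ j : ℕ, X' ω ∈ Metric.ball x (1 / (j + 1)) →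
      ∀ᶠ n in atTop, (F n ∩ Metric.ball x (1 / (j + 1))).Nonempty :=
    (ae_ball_iff hc).2 fun x _ => ae_all_iff.2 fun j => key x _
  filter_upwards [ht, key'] with ω hω hk
  rw [Metric.tendsto_atTop']
  intro ε hε
  obtain ⟨j, hj⟩ := exists_nat_one_div_lt (half_pos hε)
  obtain ⟨x, hx, hxd⟩ := Metric.mem_closure_iff.1 (htc hω) (1 / (j + 1)) Nat.one_div_pos_of_nat
  obtain ⟨N, hN⟩ := eventually_atTop.1 (hk x hx j hxd)
  refine ⟨N, fun n hn => ?_⟩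
  obtain ⟨y, hyF, hy⟩ := hN n hn.le
  rw [Real.dist_0_eq_abs, abs_of_nonneg Metric.infDist_nonneg]
  calc Metric.infDist (X' ω) (F n) ≤ dist (X' ω) y := Metric.infDist_le_dist_of_mem hyF
    _ ≤ dist (X' ω) x + dist y x := dist_triangle_right _ _ _
    _ < ε := by rw [Metric.mem_ball] at hy; linarith

/-- A point that is approximated by the sets `F n` and is a cluster point of the subsets `D n` is
the limit of a sequence of points of `F n` that is frequently in `D n`. -/
lemma exists_tendsto_frequently_mem {E : Type*} [PseudoMetricSpace E] {F D : ℕ → Set E} {z : E}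
    (hne : ∀ n, (F n).Nonempty) (hDF : ∀ n, D n ⊆ F n)
    (hz : Tendsto (fun n => Metric.infDist z (F n)) atTop (𝓝 0))
    (hD : ∀ m, z ∈ closure (⋃ n ≥ m, D n)) :
    ∃ w : ℕ → E, (∀ n, w n ∈ F n) ∧ Tendsto w atTop (𝓝 z) ∧ ∃ᶠ n in atTop, w n ∈ D n := by
  have hy : ∀ n : ℕ, ∃ y ∈ F n, dist z y < Metric.infDist z (F n) + 1 / (n + 1) := fun n =>
    (Metric.infDist_lt_iff (hne n)).1 (lt_add_of_pos_right _ Nat.one_div_pos_of_nat)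
  choose y hyF hyd using hy
  have hylim : Tendsto (fun n => dist (y n) z) atTop (𝓝 0) := by
    refine squeeze_zero (fun _ => dist_nonneg) (fun n => ?_)
      (by simpa only [add_zero] using hz.add tendsto_one_div_add_atTop_nhds_zero_nat)
    rw [dist_comm]; exact (hyd n).le
  obtain ⟨φ, hφ, hx⟩ := extraction_forall_of_frequently
    (P := fun k n : ℕ => ∃ x ∈ D n, dist x z < 1 / ((k : ℝ) + 1)) fun k => by
      refine frequently_atTop.2 fun m => ?_
      obtain ⟨x, hx, hxd⟩ := Metric.mem_closure_iff.1 (hD m) _ (Nat.one_div_pos_of_nat (n := k))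
      simp only [mem_iUnion] at hx
      obtain ⟨n, hn, hx⟩ := hx
      exact ⟨n, hn, x, hx, by rwa [dist_comm]⟩
  choose x hxD hxd using hx
  -- The sequence splices the points `x k` of `D (φ k)` into the background sequence `y` of points
  -- of `F n`.
  have hcases : ∀ n, (∃ k, φ k = n ∧ Function.extend φ x y n = x k) ∨
      Function.extend φ x y n = y n := by
    intro n
    by_cases hn : ∃ k, φ k = n
    · obtain ⟨k, rfl⟩ := hn
      exact Or.inl ⟨k, rfl, hφ.injective.extend_apply x y k⟩
    · exact Or.inr (Function.extend_apply' x y n hn)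
  refine ⟨Function.extend φ x y, fun n => ?_, Metric.tendsto_atTop.2 fun ε hε => ?_, ?_⟩
  · rcases hcases n with ⟨k, rfl, h⟩ | h
    · rw [h]; exact hDF _ (hxD k)
    · rw [h]; exact hyF n
  · obtain ⟨K, hK⟩ := exists_nat_one_div_lt hε
    obtain ⟨N, hN⟩ := eventually_atTop.1 (hylim.eventually_lt_const hε)
    refine ⟨max N (φ K), fun n hn => ?_⟩
    rcases hcases n with ⟨k, rfl, h⟩ | h
    · rw [h]
      have hk : K ≤ k := hφ.le_iff_le.1 ((le_max_right _ _).trans hn)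
      exact (hxd k).trans_le ((one_div_le_one_div_of_le (by positivity)
        (by gcongr)).trans hK.le)
    · rw [h]; exact hN n ((le_max_left _ _).trans hn)
  · refine frequently_atTop.2 fun m => ⟨φ m, hφ.le_apply, ?_⟩
    rw [hφ.injective.extend_apply]; exact hxD m

/-- A one-sided extended continuous mapping theorem for sets. -/
lemma WeakConv.limsup_measure_le_of_seq [IsProbabilityMeasure P] {E : Type*}
    [PseudoMetricSpace E] {X : ℕ → Ω → E} {X' : Ω → E} (h : WeakConv P X X') {F D : ℕ → Set E}
    (hF : ∀ n ω, X n ω ∈ F n) (hDF : ∀ n, D n ⊆ F n) {A : Set Ω}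
    (hA : ∀ ω (w : ℕ → E), (∀ n, w n ∈ F n) → Tendsto w atTop (𝓝 (X' ω)) →
      (∃ᶠ n in atTop, w n ∈ D n) → ω ∈ A) :
    limsup (fun n => P (X n ⁻¹' D n)) atTop ≤ P A := by
  have : Nonempty Ω := nonempty_of_isProbabilityMeasure P
  let C : ℕ → Set E := fun m => closure (⋃ n ≥ m, D n)
  have hC : ∀ m, limsup (fun n => P (X n ⁻¹' D n)) atTop ≤ P (X' ⁻¹' C m) := fun m => by
    refine le_trans (limsup_le_limsup ?_) (h.limsup_measure_preimage_le isClosed_closure)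
    filter_upwards [eventually_ge_atTop m] with n hn
    exact measure_mono (preimage_mono
      ((subset_iUnion₂ (s := fun n (_ : n ≥ m) => D n) n hn).trans subset_closure))
  have hanti : Antitone fun m => X' ⁻¹' C m := fun m m' hm => preimage_mono
    (closure_mono (iUnion₂_subset fun n hn =>
      subset_iUnion₂ (s := fun n (_ : n ≥ m) => D n) n (hm.trans hn)))
  have hlim := tendsto_measure_iInter_atTop (μ := P)
    (fun m => nullMeasurableSet_preimage_of_isClosed h.1 (isClosed_closure : IsClosed (C m)))
    hanti ⟨0, measure_ne_top _ _⟩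
  refine (ge_of_tendsto' hlim hC).trans (measure_mono_ae ?_)
  filter_upwards [h.ae_tendsto_infDist hF] with ω hω hmem
  obtain ⟨w, hw, hwt, hwD⟩ := exists_tendsto_frequently_mem
    (fun n => ⟨X n (Classical.arbitrary Ω), hF n _⟩) hDF hω (fun m => mem_iInter.1 hmem m)
  exact hA ω w hw hwt hwD

end WeakConvergence

/-! ### Piecewise continuous functions -/

section PiecewiseContinuous

variable {S ι : Type*} [TopologicalSpace S] {V : ι → Set S} {f : S → ℝ}

lemma IsPiecewiseContinuous.neg (hf : IsPiecewiseContinuous V f) :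
    IsPiecewiseContinuous V fun s => -f s := fun i => by
  obtain ⟨g, hg, hgf⟩ := hf i
  exact ⟨fun s => -g s, hg.neg, fun s hs => congrArg Neg.neg (hgf hs)⟩

lemma IsPiecewiseContinuous.tendsto_contExt (hf : IsPiecewiseContinuous V f) {i : ι} {s : S}
    (hs : s ∈ closure (V i)) : Tendsto f (𝓝[V i] s) (𝓝 (contExt V f i s)) := by
  obtain ⟨g, hg, hgf⟩ := hf i
  have h : Tendsto f (𝓝[V i] s) (𝓝 (g s)) :=
    (((hg s hs).mono subset_closure).tendsto).congr' (hgf.eventuallyEq_nhdsWithin)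
  rwa [contExt, extendFrom_eq hs h]

lemma IsPiecewiseContinuous.continuousOn (hf : IsPiecewiseContinuous V f) (i : ι) :
    ContinuousOn f (V i) := by
  obtain ⟨g, hg, hgf⟩ := hf i
  exact (hg.mono subset_closure).congr hgf.symm

lemma IsPiecewiseContinuous.continuousOn_contExt (hf : IsPiecewiseContinuous V f) (i : ι) :
    ContinuousOn (contExt V f i) (closure (V i)) :=
  continuousOn_extendFrom subset_rfl fun _ hs => ⟨_, hf.tendsto_contExt hs⟩

lemma IsPiecewiseContinuous.contExt_of_mem (hf : IsPiecewiseContinuous V f) {i : ι} {s : S}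
    (hs : s ∈ V i) : contExt V f i s = f s :=
  extendFrom_eq (subset_closure hs) (hf.continuousOn i s hs)

lemma IsPiecewiseContinuous.contExt_neg (hf : IsPiecewiseContinuous V f) {i : ι} {s : S}
    (hs : s ∈ closure (V i)) : contExt V (fun s => -f s) i s = -contExt V f i s :=
  extendFrom_eq hs (hf.tendsto_contExt hs).neg

lemma uPlus_subset_closure (μ : S → ℝ) (i : ι) : uPlus V μ i ⊆ closure (V i) := fun _ hs =>
  closure_mono inter_subset_right (mem_iInter₂.1 hs 1 one_pos)

lemma uMinus_subset_closure (μ : S → ℝ) (i : ι) : uMinus V μ i ⊆ closure (V i) := fun _ hs =>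
  closure_mono inter_subset_right (mem_iInter₂.1 hs 1 one_pos)

lemma uPlus_neg (μ : S → ℝ) (i : ι) : uPlus V (fun s => -μ s) i = uMinus V μ i := by
  have h : ∀ η : ℝ, (fun s => -μ s) ⁻¹' Icc 0 η = μ ⁻¹' Icc (-η) 0 := fun η => by
    ext s
    simp only [mem_preimage, mem_Icc]
    constructor <;> rintro ⟨h1, h2⟩ <;> constructor <;> linarith
  simp only [uPlus, uMinus, h]

end PiecewiseContinuous

/-- Points at which a sequence exceeds a level by a diverging multiple of a non-negative function
accumulate at a point of `uPlus` at which an upper restrained bound is at least that level. -/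
lemma IsUpperRestrainedBound.exists_mem_uPlus {S ι : Type*} [MetricSpace S] [CompactSpace S]
    {V : ι → Set S} (hV : IsLocallyFinitePartition V) {fn : ℕ → S → ℝ} {f : S → ℝ}
    (hf : IsPiecewiseContinuous V f) (hb : IsUpperRestrainedBound V fn f) {ν : S → ℝ}
    {τ : ℕ → ℝ} (hτ_pos : ∀ n, 0 < τ n) (hτ : Tendsto τ atTop (𝓝 0)) {q : ℝ}
    (h : ∃ᶠ n in atTop, ∃ s, 0 ≤ ν s ∧ q + (τ n)⁻¹ * ν s < fn n s) :
    ∃ i, ∃ s ∈ uPlus V ν i, q ≤ contExt V f i s := by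
  have : Finite ι := finite_univ_iff.1 (hV.locallyFinite.finite_of_compact hV.nonempty)
  obtain ⟨_, s₀, -⟩ := h.exists
  have : Nonempty S := ⟨s₀⟩
  have : (atTop ⊓ 𝓟 {n | ∃ s, 0 ≤ ν s ∧ q + (τ n)⁻¹ * ν s < fn n s}).NeBot :=
    frequently_iff_neBot.1 h
  -- An ultrafilter replaces successive subsequences: along it the bad points converge and stay in
  -- one of the finitely many cells.
  obtain ⟨u, hu⟩ := Ultrafilter.exists_le
    (atTop ⊓ 𝓟 {n | ∃ s, 0 ≤ ν s ∧ q + (τ n)⁻¹ * ν s < fn n s})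
  have hu_top : (u : Filter ℕ) ≤ atTop := hu.trans inf_le_left
  have hu_mem : ∀ᶠ n in (u : Filter ℕ), ∃ s, 0 ≤ ν s ∧ q + (τ n)⁻¹ * ν s < fn n s :=
    (hu.trans inf_le_right) (mem_principal_self _)
  have hchoose : ∀ n, ∃ s, (∃ s, 0 ≤ ν s ∧ q + (τ n)⁻¹ * ν s < fn n s) →
      0 ≤ ν s ∧ q + (τ n)⁻¹ * ν s < fn n s := fun n => by
    by_cases hn : ∃ s, 0 ≤ ν s ∧ q + (τ n)⁻¹ * ν s < fn n s
    · obtain ⟨s, hs⟩ := hn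
      exact ⟨s, fun _ => hs⟩
    · exact ⟨s₀, fun hn' => absurd hn' hn⟩
  choose x hx using hchoose
  replace hx : ∀ᶠ n in (u : Filter ℕ), 0 ≤ ν (x n) ∧ q + (τ n)⁻¹ * ν (x n) < fn n (x n) :=
    hu_mem.mono hx
  obtain ⟨s, -, hs⟩ := (isCompact_univ (X := S)).ultrafilter_le_nhds (u.map x) (by simp)
  have hxs : Tendsto x u (𝓝 s) := hs
  obtain ⟨i, hi⟩ : ∃ i, ∀ᶠ n in (u : Filter ℕ), x n ∈ V i :=
    Ultrafilter.eventually_exists_iff.1 (Eventually.of_forall fun n =>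
      mem_iUnion.1 (hV.cover ▸ mem_univ (x n)))
  have hsi : s ∈ closure (V i) := mem_closure_of_tendsto hxs hi
  have hle : ∀ B : ℝ, (∀ᶠ n in (u : Filter ℕ), B ≤ fn n (x n)) →
      B ≤ max (contExt V f i s) (f s) := fun B hB => by
    refine EReal.coe_le_coe_iff.1 (le_trans (le_iInf₂ fun δ hδ => ?_) (hb i s hsi))
    refine le_limsup_of_frequently_le' (Frequently.filter_mono (Eventually.frequently ?_) hu_top)
    filter_upwards [hB, hi, hxs (Metric.ball_mem_nhds s hδ)] with n h1 h2 h3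
    exact (EReal.coe_le_coe_iff.2 h1).trans
      (le_iSup₂ (f := fun s' (_ : s' ∈ Metric.ball s δ ∩ V i) => ((fn n s' : ℝ) : EReal))
        (x n) ⟨h3, h2⟩)
  have hq : q ≤ max (contExt V f i s) (f s) := hle q (by
    filter_upwards [hx] with n hn
    have := mul_nonneg (inv_pos.2 (hτ_pos n)).le hn.1
    linarith [hn.2])
  have hinv : Tendsto (fun n => (τ n)⁻¹) u atTop :=
    (Tendsto.inv_tendsto_nhdsGT_zero (tendsto_nhdsWithin_iff.2
      ⟨hτ, Eventually.of_forall hτ_pos⟩)).mono_left hu_top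
  -- Otherwise `ν (x n) > η` along `u`, so `fn n (x n)` would exceed any constant, in particular the
  -- restrained bound plus `1`.
  have hν : ∀ η > 0, ∀ᶠ n in (u : Filter ℕ), x n ∈ ν ⁻¹' Icc 0 η := fun η hη => by
    by_contra hcon
    rw [← Ultrafilter.eventually_not] at hcon
    have := hle (max (contExt V f i s) (f s) + 1) (by
      filter_upwards [hcon, hx, (hinv.atTop_mul_const hη).eventually_ge_atTop
        (max (contExt V f i s) (f s) + 1 - q)] with n h1 h2 h3
      have h4 : η ≤ ν (x n) := (not_le.1 fun h => h1 ⟨h2.1, h⟩).le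
      have h5 := mul_le_mul_of_nonneg_left h4 (inv_pos.2 (hτ_pos n)).le
      linarith [h2.2])
    linarith
  -- If `f s` attains the maximum, the relevant cell is the one containing `s`, which the `x n` need
  -- not visit. The inner closure in `uPlus` is what admits `s` there.
  rcases le_max_iff.1 hq with hq | hq
  · exact ⟨i, s, mem_iInter₂.2 fun η hη => mem_closure_of_tendsto hxs
      (((hν η hη).and hi).mono fun n hn => ⟨subset_closure hn.1, hn.2⟩), hq⟩
  · obtain ⟨j, hj⟩ := mem_iUnion.1 (hV.cover ▸ mem_univ s)
    exact ⟨j, s, mem_iInter₂.2 fun η hη => subset_closure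
      ⟨mem_closure_of_tendsto hxs (hν η hη), hj⟩, hq.trans_eq (hf.contExt_of_mem hj).symm⟩

/-! ### Measurability of suprema -/

lemma biSup_eq_biSup_of_dense {S : Type*} [TopologicalSpace S] {g : S → EReal} {K D : Set S}
    (hg : ContinuousOn g K) (hDK : D ⊆ K) (hKD : K ⊆ closure D) :
    ⨆ s ∈ K, g s = ⨆ s ∈ D, g s := by
  refine le_antisymm (iSup₂_le fun s hs => ?_) (biSup_mono hDK)
  have h := ((hg s hs).mono hDK).mem_closure_image (hKD hs)
  have hsub : g '' D ⊆ Iic (⨆ s ∈ D, g s) :=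
    image_subset_iff.2 fun t ht => mem_Iic.2 (le_iSup₂ (f := fun s (_ : s ∈ D) => g s) t ht)
  exact closure_minimal hsub isClosed_Iic h

section Measurability

variable {Ω S ι : Type*} [MeasurableSpace Ω] {P : Measure Ω} [MetricSpace S]
  {V : ι → Set S} {X : Ω → S → ℝ}

/-- The extension is a limit of coordinates along one sequence in `V i`, chosen independently of
`ω`. -/
lemma aemeasurable_contExt (hX : ∀ ω, IsPiecewiseContinuous V (X ω))
    (hm : ∀ s, AEMeasurable (fun ω => X ω s) P) {i : ι} {s : S} (hs : s ∈ closure (V i)) :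
    AEMeasurable (fun ω => contExt V (X ω) i s) P := by
  obtain ⟨x, hxV, hx⟩ := mem_closure_iff_seq_limit.1 hs
  have hx' : Tendsto x atTop (𝓝[V i] s) :=
    tendsto_nhdsWithin_iff.2 ⟨hx, Eventually.of_forall hxV⟩
  exact aemeasurable_of_tendsto_metrizable_ae atTop (fun n => hm (x n))
    (ae_of_all _ fun ω => ((hX ω).tendsto_contExt hs).comp hx')

lemma aemeasurable_biSup_contExt [CompactSpace S] (hX : ∀ ω, IsPiecewiseContinuous V (X ω))
    (hm : ∀ s, AEMeasurable (fun ω => X ω s) P) {i : ι} {K : Set S} (hK : K ⊆ closure (V i)) :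
    AEMeasurable (fun ω => ⨆ s ∈ K, ((contExt V (X ω) i s : ℝ) : EReal)) P := by
  obtain ⟨D, hDK, hDc, hKD⟩ :=
    (TopologicalSpace.IsSeparable.of_separableSpace K).exists_countable_dense_subset
  have h : ∀ ω, ⨆ s ∈ K, ((contExt V (X ω) i s : ℝ) : EReal) =
      ⨆ s : D, ((contExt V (X ω) i s : ℝ) : EReal) := fun ω => by
    have hc : ContinuousOn (fun s => ((contExt V (X ω) i s : ℝ) : EReal)) K :=
      continuous_coe_real_ereal.comp_continuousOn (((hX ω).continuousOn_contExt i).mono hK)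
    rw [biSup_eq_biSup_of_dense hc hDK hKD, iSup_subtype']
  simp only [h]
  have := hDc.to_subtype
  exact AEMeasurable.iSup fun s => (aemeasurable_contExt hX hm (hK (hDK s.2))).coe_real_ereal

end Measurability

/-! ### The two bounds on the inclusion probability -/

section InclusionProbability

variable {S ι : Type*} {V : ι → Set S}

section Extremal

variable [TopologicalSpace S]

/-- The supremum that bounds the critical value from below, as a function of the paths of the
limits of the two bounding processes. -/
noncomputable def supExtremal (V : ι → Set S) (μ : S → ℝ) (l u : S → ℝ) : EReal :=
  ⨆ i : ι, max (⨆ s ∈ uPlus V μ i, ((-(contExt V l i s) : ℝ) : EReal))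
    (⨆ s ∈ uMinus V μ i, ((contExt V u i s : ℝ) : EReal))

lemma le_supExtremal_of_mem_uPlus {μ l u : S → ℝ} {i : ι} {s : S} (hs : s ∈ uPlus V μ i) :
    ((-(contExt V l i s) : ℝ) : EReal) ≤ supExtremal V μ l u :=
  (le_iSup₂ (f := fun s (_ : s ∈ uPlus V μ i) => ((-(contExt V l i s) : ℝ) : EReal)) s hs).trans
    ((le_max_left _ _).trans (le_iSup (fun i : ι => max
      (⨆ s ∈ uPlus V μ i, ((-(contExt V l i s) : ℝ) : EReal))
      (⨆ s ∈ uMinus V μ i, ((contExt V u i s : ℝ) : EReal))) i))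

lemma le_supExtremal_of_mem_uMinus {μ l u : S → ℝ} {i : ι} {s : S} (hs : s ∈ uMinus V μ i) :
    ((contExt V u i s : ℝ) : EReal) ≤ supExtremal V μ l u :=
  (le_iSup₂ (f := fun s (_ : s ∈ uMinus V μ i) => ((contExt V u i s : ℝ) : EReal)) s hs).trans
    ((le_max_right _ _).trans (le_iSup (fun i : ι => max
      (⨆ s ∈ uPlus V μ i, ((-(contExt V l i s) : ℝ) : EReal))
      (⨆ s ∈ uMinus V μ i, ((contExt V u i s : ℝ) : EReal))) i))

end Extremal

lemma inv_mul_eq_normalizedError_add {Ω : Type*} {τ : ℕ → ℝ} {μ : LInf S}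
    {μhat : ℕ → Ω → LInf S} (n : ℕ) (ω : Ω) (s : S) :
    (τ n)⁻¹ * μhat n ω s = normalizedError τ μ μhat n ω s + (τ n)⁻¹ * μ s := by
  simp only [normalizedError, lp.coeFn_smul, lp.coeFn_sub, Pi.smul_apply, Pi.sub_apply,
    smul_eq_mul]
  ring

variable {Ω : Type*} [MeasurableSpace Ω] {P : Measure Ω} [MetricSpace S]
  [CompactSpace S] {μ : LInf S} {μhat : ℕ → Ω → LInf S}
  {τ : ℕ → ℝ} {q : ℝ}

lemma aemeasurable_supExtremal [Countable ι] {ν : S → ℝ} {L U : Ω → S → ℝ}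
    (hL : ∀ ω, IsPiecewiseContinuous V (L ω)) (hLm : ∀ s, AEMeasurable (fun ω => L ω s) P)
    (hU : ∀ ω, IsPiecewiseContinuous V (U ω)) (hUm : ∀ s, AEMeasurable (fun ω => U ω s) P) :
    AEMeasurable (fun ω => supExtremal V ν (L ω) (U ω)) P := by
  refine AEMeasurable.iSup fun i => AEMeasurable.max ?_ ?_
  · refine (aemeasurable_biSup_contExt (fun ω => (hL ω).neg) (fun s => (hLm s).neg)
      (uPlus_subset_closure (V := V) ν i)).congr (ae_of_all _ fun ω => ?_)
    exact iSup_congr fun s => iSup_congr fun hs => by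
      rw [(hL ω).contExt_neg (uPlus_subset_closure ν i hs)]
  · exact aemeasurable_biSup_contExt hU hUm (uMinus_subset_closure ν i)

variable [IsProbabilityMeasure P]

lemma limsup_measure_compl_inclusionEvent_le (hV : IsLocallyFinitePartition V)
    (hτ_pos : ∀ n, 0 < τ n) (hτ : Tendsto τ atTop (𝓝 0)) {Lhat Uhat : ℕ → Ω → LInf S}
    {L U : Ω → S → ℝ} (hconf : IsConfinement P V (normalizedError τ μ μhat) Lhat Uhat L U) :
    limsup (fun n => P (inclusionEvent τ μ μhat q n)ᶜ) atTop ≤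
      P {ω | (q : EReal) ≤ supExtremal V μ (L ω) (U ω)} := by
  obtain ⟨hbd, k, l, Gn, G, Gn', G', ⟨-, F, Fn, Lt, Ltn, ⟨hpc, hpres⟩, hGn, hG, hLn, hL⟩,
    ⟨-, F', Fn', Ut, Utn, ⟨hpc', hpres'⟩, hGn', hG', hUn, hU⟩, hw⟩ := hconf
  -- Failure is expressed through the pair of building blocks, because either side may fail; this is
  -- where joint convergence enters.
  let D : ℕ → Set ((Fin k → LInf S) × (Fin l → LInf S)) := fun n =>
    {z | z ∈ Fn n ×ˢ Fn' n ∧ ((∃ s, 0 ≤ μ s ∧ q + (τ n)⁻¹ * μ s < -Ltn n z.1 s) ∨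
      ∃ s, 0 ≤ -μ s ∧ q + (τ n)⁻¹ * -μ s < Utn n z.2 s)}
  refine le_trans (limsup_le_limsup (Eventually.of_forall fun n => measure_mono_ae ?_))
    (hw.limsup_measure_le_of_seq (F := fun n => Fn n ×ˢ Fn' n) (D := D)
      (fun n ω => ⟨hGn n ω, hGn' n ω⟩) (fun n z hz => hz.1) ?_)
  · filter_upwards [hbd n] with ω hω hmem
    refine ⟨⟨hGn n ω, hGn' n ω⟩, ?_⟩
    rcases not_and_or.1 hmem with h | h
    · obtain ⟨s, hs, hs'⟩ := not_subset.1 h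
      refine Or.inl ⟨s, not_lt.1 hs', ?_⟩
      rw [mem_ofPred_eq, inv_mul_eq_normalizedError_add (μ := μ)] at hs
      have := (hω s).1
      rw [hLn] at this
      linarith
    · obtain ⟨s, hs, hs'⟩ := not_subset.1 h
      refine Or.inr ⟨s, neg_nonneg.2 (not_lt.1 hs'), ?_⟩
      rw [mem_ofPred_eq, inv_mul_eq_normalizedError_add (μ := μ)] at hs
      have := (hω s).2
      rw [hUn] at this
      linarith
  · intro ω w hwF hwt hwD
    rcases frequently_or_distrib.1 (hwD.mono fun n hn => hn.2) with h | h
    · have hb := hpres (fun n => (w n).1) (G ω) (fun n => (hwF n).1) (hG ω)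
        ((continuous_fst.tendsto _).comp hwt)
      obtain ⟨i, s, hs, hq⟩ := IsUpperRestrainedBound.exists_mem_uPlus hV (hpc _ (hG ω)).neg hb
        hτ_pos hτ h
      rw [(hpc _ (hG ω)).contExt_neg (uPlus_subset_closure _ i hs), ← hL ω] at hq
      exact (EReal.coe_le_coe_iff.2 hq).trans (le_supExtremal_of_mem_uPlus hs)
    · have hb := hpres' (fun n => (w n).2) (G' ω) (fun n => (hwF n).2) (hG' ω)
        ((continuous_snd.tendsto _).comp hwt)
      obtain ⟨i, s, hs, hq⟩ := IsUpperRestrainedBound.exists_mem_uPlus hV (hpc' _ (hG' ω)) hb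
        hτ_pos hτ h
      rw [uPlus_neg] at hs
      rw [← hU ω] at hq
      exact (EReal.coe_le_coe_iff.2 hq).trans (le_supExtremal_of_mem_uMinus hs)

lemma le_liminf_innerProb_inclusionEvent [Countable ι] (hV : IsLocallyFinitePartition V)
    (hτ_pos : ∀ n, 0 < τ n) (hτ : Tendsto τ atTop (𝓝 0)) {Lhat Uhat : ℕ → Ω → LInf S}
    {L U : Ω → S → ℝ} (hconf : IsConfinement P V (normalizedError τ μ μhat) Lhat Uhat L U) :
    P {ω | supExtremal V μ (L ω) (U ω) < q} ≤
      liminf (fun n => innerProb P (inclusionEvent τ μ μhat q n)) atTop := by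
  have hle := limsup_measure_compl_inclusionEvent_le (q := q) hV hτ_pos hτ hconf
  obtain ⟨-, k, l, Gn, G, Gn', G', ⟨hLw, F, Fn, Lt, Ltn, ⟨hpc, -⟩, -, hG, -, hL⟩,
    ⟨hUw, F', Fn', Ut, Utn, ⟨hpc', -⟩, -, hG', -, hU⟩, -⟩ := hconf
  -- Passing to the complement needs null measurability of the limit event: outer measure alone is
  -- not additive on complements.
  have hm : AEMeasurable (fun ω => supExtremal V μ (L ω) (U ω)) P :=
    aemeasurable_supExtremal (fun ω => hL ω ▸ hpc _ (hG ω)) (fun s => (hLw s).1.aemeasurable)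
      (fun ω => hU ω ▸ hpc' _ (hG' ω)) fun s => (hUw s).1.aemeasurable
  have hset : {ω | supExtremal V μ (L ω) (U ω) < q} =
      {ω | (q : EReal) ≤ supExtremal V μ (L ω) (U ω)}ᶜ := by
    ext ω; simp
  have hnull : NullMeasurableSet {ω | (q : EReal) ≤ supExtremal V μ (L ω) (U ω)} P :=
    hm.nullMeasurable measurableSet_Ici
  rw [hset, prob_compl_eq_one_sub₀ hnull]
  simp only [innerProb, outerProb_eq]
  rw [ENNReal.liminf_const_sub _ _ ENNReal.one_ne_top]
  exact tsub_le_tsub_left hle 1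

lemma limsup_outerProb_inclusionEvent_le [Countable ι] (hV : IsLocallyFinitePartition V)
    {H : Ω → S → ℝ} (hH : ∀ ω, IsPiecewiseContinuous V (H ω))
    (hCLT : FiniteDimWeakConv P (fun n ω => (normalizedError τ μ μhat n ω : S → ℝ)) H) :
    limsup (fun n => outerProb P (inclusionEvent τ μ μhat q n)) atTop ≤
      P {ω | (⨆ s ∈ {s : S | μ s = 0}, ((|H ω s| : ℝ) : EReal)) ≤ (q : EReal)} := by
  -- Density is required cell by cell, since the paths of `H` may jump between cells.
  have hdense : ∀ i, ∃ D ⊆ {s | μ s = 0} ∩ V i, D.Countable ∧ {s | μ s = 0} ∩ V i ⊆ closure D :=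
    fun i => (TopologicalSpace.IsSeparable.of_separableSpace _).exists_countable_dense_subset
  choose D hDsub hDc hDd using hdense
  have hDcount : Countable (⋃ i, D i : Set S) := (countable_iUnion hDc).to_subtype
  let A : Finset (⋃ i, D i : Set S) → Set Ω := fun T => {ω | ∀ t ∈ T, |H ω t| ≤ q}
  have hA : ∀ T, NullMeasurableSet (A T) P ∧
      limsup (fun n => outerProb P (inclusionEvent τ μ μhat q n)) atTop ≤ P (A T) := by
    intro T
    let T' : Finset S := T.map (Function.Embedding.subtype _)
    let C : Set (T' → ℝ) := {x | ∀ t, |x t| ≤ q}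
    have hC : IsClosed C := by
      simp only [C, ofPred_forall]
      exact isClosed_iInter fun t => isClosed_le (continuous_apply t).abs continuous_const
    have hAC : A T = (fun ω => fun t : T' => H ω t) ⁻¹' C := by
      ext ω
      simp [A, C, T']
    rw [hAC]
    refine ⟨nullMeasurableSet_preimage_of_isClosed (hCLT T').1 hC,
      le_trans (limsup_le_limsup (Eventually.of_forall fun n => ?_))
        ((hCLT T').limsup_measure_preimage_le hC)⟩
    simp only [outerProb_eq]
    refine measure_mono fun ω hω t => ?_
    have ht : μ (t : S) = 0 := by
      obtain ⟨t', -, ht'⟩ := Finset.mem_map.1 t.2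
      obtain ⟨i, hi⟩ := mem_iUnion.1 t'.2
      rw [← ht']
      exact (hDsub i hi).1
    have h := inv_mul_eq_normalizedError_add (τ := τ) (μ := μ) (μhat := μhat) n ω (t : S)
    rw [ht, mul_zero, add_zero] at h
    change |normalizedError τ μ μhat n ω t| ≤ q
    rw [← h, abs_le]
    exact ⟨not_lt.1 fun hlt => (hω.1 hlt).ne ht, not_lt.1 fun hlt => (hω.2 hlt).ne' ht⟩
  have hanti : Antitone A := fun T T' hT ω hω t ht => hω t (hT ht)
  -- The finite subsets of a countable set form a countable directed family, so continuity from
  -- above applies.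
  have hinter := hanti.measure_iInter (μ := P) (fun T => (hA T).1) ⟨∅, measure_ne_top _ _⟩
  refine (le_iInf fun T => (hA T).2).trans (hinter.symm.le.trans (measure_mono fun ω hω => ?_))
  refine iSup₂_le fun s hs => EReal.coe_le_coe_iff.2 ?_
  obtain ⟨i, hi⟩ := mem_iUnion.1 (hV.cover ▸ mem_univ s)
  have hmem := ((((hH ω).continuousOn i s hi).mono
    ((hDsub i).trans inter_subset_right)).abs).mem_closure_image (hDd i ⟨hs, hi⟩)
  have hsub : (fun s => |H ω s|) '' D i ⊆ Iic q := by
    rintro _ ⟨t, ht, rfl⟩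
    let t' : (⋃ i, D i : Set S) := ⟨t, mem_iUnion.2 ⟨i, ht⟩⟩
    exact mem_iInter.1 hω {t'} t' (Finset.mem_singleton_self t')
  exact closure_minimal hsub isClosed_Iic hmem

end InclusionProbability

end ConfidenceRegions

theorem mainTheorem1 {Ω S ι : Type*} [MeasurableSpace Ω] (P : Measure Ω) [IsProbabilityMeasure P]
    [MetricSpace S] [CompactSpace S] [Countable ι]
    (V : ι → Set S) (hV : IsLocallyFinitePartition V)
    (μ : LInf S) (μhat : ℕ → Ω → LInf S)
    (τ : ℕ → ℝ) (hτ_pos : ∀ n, 0 < τ n) (hτ : Tendsto τ atTop (𝓝 0))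
    (H : Ω → S → ℝ) (hH : ∀ ω, IsPiecewiseContinuous V (H ω))
    (hCLT : FiniteDimWeakConv P (fun n ω => (normalizedError τ μ μhat n ω : S → ℝ)) H)
    (Lhat Uhat : ℕ → Ω → LInf S) (L U : Ω → S → ℝ)
    (hconf : IsConfinement P V (normalizedError τ μ μhat) Lhat Uhat L U)
    (q : ℝ) :
    P {ω | (⨆ i : ι, max
          (⨆ s ∈ uPlus V μ i, ((-(contExt V (L ω) i s) : ℝ) : EReal))
          (⨆ s ∈ uMinus V μ i, ((contExt V (U ω) i s : ℝ) : EReal))) < (q : EReal)} ≤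
        liminf (fun n => innerProb P (inclusionEvent τ μ μhat q n)) atTop ∧
      limsup (fun n => outerProb P (inclusionEvent τ μ μhat q n)) atTop ≤
        P {ω | (⨆ s ∈ {s : S | μ s = 0}, ((|H ω s| : ℝ) : EReal)) ≤ (q : EReal)} :=
  ⟨le_liminf_innerProb_inclusionEvent hV hτ_pos hτ hconf,
    limsup_outerProb_inclusionEvent_le hV hH hCLT⟩
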